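/- Let $H^1(\mathbb{R})=W^{1,2}(\mathbb{R})$ be the real-valued Sobolev space of all $u\in L^2(\mathbb{R})$ whose weak derivative $u'$ exists and lies in $L^2(\mathbb{R})$, with functions that agree almost everywhere identified. For a constant $V>0$ put $$R(u;V)=\frac{\int_{-\infty}^{\infty}\left(|u'(x)|^2+V|u(x)|^2\right)dx}{\|u\|_{L^\infty(\mathbb{R})}^2}\qquad (u\in H^1(\mathbb{R}),\ u\not\equiv 0),$$ $$m(V)=\inf_{u\in H^1(\mathbb{R}),\,u\not\equiv 0}R(u;V),\qquad M(V)=\{u\in H^1(\mathbb{R}) : u\not\equiv 0,\ R(u;V)=m(V)\}.$$ Then, for every constant $V>0$, $$m(V)=2\sqrt{V},\qquad M(V)=\{c\,u_a : c\in\mathbb{R}\setminus\{0\},\ a\in\mathbb{R}\},\quad\text{where } u_a(x)=e^{-\sqrt{V}\,|x-a|}.$$ That is, the minimizers of $R(\cdot;V)$ over the nonzero elements of $H^1(\mathbb{R})$ are exactly the functions $c\,e^{-\sqrt{V}|x-a|}$ with $c\neq 0$ and $a\in\mathbb{R}$. -/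

import Mathlib

open MeasureTheory
open scoped ContDiff

namespace SobolevBest

/-- `g` is a weak derivative of `u` on `ℝ`: both are locally integrable and
`∫ u φ' = - ∫ g φ` for every smooth compactly supported test function `φ`. -/
def HasWeakDeriv (u g : ℝ → ℝ) : Prop :=
  LocallyIntegrable u volume ∧ LocallyIntegrable g volume ∧
    ∀ φ : ℝ → ℝ, ContDiff ℝ ∞ φ → HasCompactSupport φ →
      ∫ x, u x * deriv φ x = -∫ x, g x * φ x

/-- Weak derivatives are unique almost everywhere. -/
theorem HasWeakDeriv.ae_eq {u g h : ℝ → ℝ} (hg : HasWeakDeriv u g) (hh : HasWeakDeriv u h) :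
    g =ᵐ[volume] h := by
  refine ae_eq_of_integral_contDiff_smul_eq hg.2.1 hh.2.1 fun φ hφ hc => ?_
  have h1 := hg.2.2 φ hφ hc
  have h2 := hh.2.2 φ hφ hc
  simp only [smul_eq_mul, mul_comm (φ _)]
  linarith

open Classical in
/-- The weak derivative `u'` (some representative of it; zero if there is no weak derivative). -/
noncomputable def weakDeriv (u : ℝ → ℝ) : ℝ → ℝ :=
  if h : ∃ g, HasWeakDeriv u g then h.choose else 0

theorem HasWeakDeriv.weakDeriv_ae_eq {u g : ℝ → ℝ} (hg : HasWeakDeriv u g) :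
    weakDeriv u =ᵐ[volume] g := by
  have h : ∃ g, HasWeakDeriv u g := ⟨g, hg⟩
  rw [weakDeriv, dif_pos h]
  exact h.choose_spec.ae_eq hg

/-- The real Sobolev space `H¹(ℝ) = W^{1,2}(ℝ)`, as the set of all representatives of its
elements: `u ∈ L²(ℝ)` with a weak derivative in `L²(ℝ)`. -/
def H1 : Set (ℝ → ℝ) :=
  {u | MemLp u 2 volume ∧ ∃ g, HasWeakDeriv u g ∧ MemLp g 2 volume}

/-- `‖u‖_V² = ∫ (|u'|² + V |u|²) dx`. -/
noncomputable def energy (u V : ℝ → ℝ) : ℝ :=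
  ∫ x, (|weakDeriv u x| ^ 2 + V x * |u x| ^ 2)

/-- `‖u‖_∞`, the norm of `L^∞(ℝ)` (essential supremum of `|u|`). -/
noncomputable def supNorm (u : ℝ → ℝ) : ℝ :=
  (eLpNorm u ⊤ volume).toReal

/-- The Rayleigh-type quotient `R(u; V) = ‖u‖_V² / ‖u‖_∞²`. -/
noncomputable def rayleigh (u V : ℝ → ℝ) : ℝ :=
  energy u V / supNorm u ^ 2

/-- `m(V) = inf {R(u; V) : u ∈ H¹(ℝ), u ≢ 0}`. -/
noncomputable def m (V : ℝ → ℝ) : ℝ :=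
  sInf {r | ∃ u ∈ H1, ¬ u =ᵐ[volume] 0 ∧ r = rayleigh u V}

/-- `M(V)`, the set of minimizers: all `u ∈ H¹(ℝ)`, `u ≢ 0`, with `R(u; V) = m(V)`. Like `H1`,
it contains every representative of each of its elements. -/
def M (V : ℝ → ℝ) : Set (ℝ → ℝ) :=
  {u | u ∈ H1 ∧ ¬ u =ᵐ[volume] 0 ∧ m V = rayleigh u V}

end SobolevBest

namespace SobolevBest

/-! Put s = √V. An element of H¹ has an absolutely continuous representative U with U' = g a.e.
(`HasWeakDeriv.exists_isPrimitive`, via du Bois-Reymond). Since (U²)' = 2Ug is integrable, U tends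
to 0 at ±∞, so |U| attains its maximum, the sup norm, at some a. Let σ be 1 left of a and -1 right
of a. Integrating (U²)' over each half-line gives U(a)² twice, so completing the square yields ∫ (g²
+ s²U²) = ∫ (g - sσU)² + 2s U(a)² (`IsPrimitive.integral_sq_add`). Dividing by U(a)² gives R ≥ 2s,
with equality iff g = sσU a.e. This linear equation forces U = U(a) e^{-s|x-a|}
(`IsPrimitive.eq_exp`), and these exponentials do satisfy it. -/

open Filter Topology Set

/-! ### Indefinite integrals and their calculus -/

/-- `U` is an indefinite integral of the locally integrable function `g`. -/
def IsPrimitive (U g : ℝ → ℝ) : Prop :=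
  LocallyIntegrable g volume ∧ ∀ x y, U y - U x = ∫ t in x..y, g t

theorem _root_.MeasureTheory.LocallyIntegrable.intervalIntegrable_real {g : ℝ → ℝ}
    (hg : LocallyIntegrable g volume) (a b : ℝ) : IntervalIntegrable g volume a b :=
  intervalIntegrable_iff.mpr <|
    (hg.integrableOn_isCompact isCompact_uIcc).mono_set uIoc_subset_uIcc

theorem isPrimitive_integral {g : ℝ → ℝ} (hg : LocallyIntegrable g volume) (C : ℝ) :
    IsPrimitive (fun x => C + ∫ t in (0 : ℝ)..x, g t) g := by
  refine ⟨hg, fun x y => ?_⟩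
  have := intervalIntegral.integral_add_adjacent_intervals
    (hg.intervalIntegrable_real 0 x) (hg.intervalIntegrable_real x y)
  simp only
  linarith

namespace IsPrimitive

variable {U F g f : ℝ → ℝ}

theorem eq_add (h : IsPrimitive U g) (a x : ℝ) : U x = U a + ∫ t in a..x, g t := by
  rw [← h.2]; ring

theorem absolutelyContinuousOnInterval (h : IsPrimitive U g) (a b : ℝ) :
    AbsolutelyContinuousOnInterval U a b := by
  have h1 := (h.1.intervalIntegrable_real a b).absolutelyContinuousOnInterval_intervalIntegral
    (c := a) (by simp)
  have h2 : AbsolutelyContinuousOnInterval (fun _ : ℝ => U a) a b :=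
    contDiff_const.contDiffOn.absolutelyContinuousOnInterval
  have h3 : U = (fun _ : ℝ => U a) + fun x => ∫ t in a..x, g t :=
    funext fun x => h.eq_add a x
  rw [h3]
  exact h2.add h1

theorem ae_deriv_eq (h : IsPrimitive U g) : ∀ᵐ x, deriv U x = g x := by
  filter_upwards [_root_.LocallyIntegrable.ae_hasDerivAt_integral h.1] with x hx
  have h1 := (hx 0).const_add (U 0)
  rw [← funext fun x => h.eq_add 0 x] at h1
  exact h1.deriv

theorem continuous (h : IsPrimitive U g) : Continuous U := by
  rw [funext fun x => h.eq_add 0 x]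
  exact continuous_const.add
    (intervalIntegral.continuous_primitive (h.1.intervalIntegrable_real) 0)

theorem mul (hU : IsPrimitive U g) (hF : IsPrimitive F f) :
    IsPrimitive (fun x => U x * F x) (fun x => g x * F x + U x * f x) := by
  refine ⟨?_, fun x y => ?_⟩
  · refine LocallyIntegrable.add ?_ ?_
    · rw [← locallyIntegrableOn_univ]
      exact (locallyIntegrableOn_univ.2 hU.1).mul_continuousOn hF.continuous.continuousOn
        isOpen_univ.isLocallyClosed
    · rw [← locallyIntegrableOn_univ]
      exact (locallyIntegrableOn_univ.2 hF.1).continuousOn_mul hU.continuous.continuousOn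
        isOpen_univ.isLocallyClosed
  · rw [← (hU.absolutelyContinuousOnInterval x y).integral_deriv_mul_eq_sub
      (hF.absolutelyContinuousOnInterval x y)]
    refine intervalIntegral.integral_congr_ae ?_
    filter_upwards [hU.ae_deriv_eq, hF.ae_deriv_eq] with t h1 h2 _
    rw [h1, h2]

theorem _root_.ContDiff.isPrimitive (hF : ContDiff ℝ 1 F) : IsPrimitive F (deriv F) := by
  have hc : Continuous (deriv F) := hF.continuous_deriv le_rfl
  exact ⟨hc.locallyIntegrable, fun x y => (intervalIntegral.integral_deriv_eq_sub
    (fun t _ => (hF.differentiable one_ne_zero) t) (hc.intervalIntegrable x y)).symm⟩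

/-- Integrability of g gives U a limit at +∞, and integrability of U forces that limit to be 0. -/
theorem integral_Ioi (h : IsPrimitive U g) (hg : Integrable g) (hU : Integrable U) (a : ℝ) :
    ∫ x in Ioi a, g x = -U a := by
  have h1 := (intervalIntegral_tendsto_integral_Ioi a hg.integrableOn tendsto_id).const_add (U a)
  simp only [id, ← h.eq_add] at h1
  have h2 := IntegrableAtFilter.eq_zero_of_tendsto (hU.integrableAtFilter atTop)
    (fun s hs => ?_) h1
  · linarith
  -- Every set in `atTop` contains a half-line, so it has infinite measure.
  · rcases mem_atTop_sets.1 hs with ⟨b, hb⟩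
    rw [← top_le_iff, ← Real.volume_Ici (a := b)]
    exact measure_mono hb

theorem integral_Iic (h : IsPrimitive U g) (hg : Integrable g) (hU : Integrable U) (a : ℝ) :
    ∫ x in Iic a, g x = U a := by
  have h1 := (intervalIntegral_tendsto_integral_Iic a hg.integrableOn tendsto_id).const_sub (U a)
  have h3 : (fun x => U a - ∫ t in (id x)..a, g t) = U := by
    ext x
    rw [← h.2]
    simp
  rw [h3] at h1
  have h2 := IntegrableAtFilter.eq_zero_of_tendsto (hU.integrableAtFilter atBot)
    (fun s hs => ?_) h1
  · linarith
  · rcases mem_atBot_sets.1 hs with ⟨b, hb⟩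
    rw [← top_le_iff, ← Real.volume_Iic (a := b)]
    exact measure_mono hb

theorem hasWeakDeriv (h : IsPrimitive U g) : HasWeakDeriv U g := by
  refine ⟨h.continuous.locallyIntegrable, h.1, fun φ hφ hc => ?_⟩
  have h1 : ContDiff ℝ 1 φ := hφ.of_le (by norm_cast)
  have hφ' : Continuous (deriv φ) := h1.continuous_deriv le_rfl
  have hp := h.mul h1.isPrimitive
  have i1 : Integrable (fun x => g x * φ x) := by
    have := h.1.integrable_smul_left_of_hasCompactSupport hφ.continuous hc
    simpa [mul_comm] using! this
  have i2 : Integrable (fun x => U x * deriv φ x) :=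
    (h.continuous.mul hφ').integrable_of_hasCompactSupport hc.deriv.mul_left
  have i3 : Integrable (fun x => U x * φ x) :=
    (h.continuous.mul hφ.continuous).integrable_of_hasCompactSupport hc.mul_left
  have e1 := hp.integral_Ioi (i1.add i2) i3 0
  have e2 := hp.integral_Iic (i1.add i2) i3 0
  have e3 := intervalIntegral.integral_Iic_add_Ioi (b := (0 : ℝ)) (i1.add i2).integrableOn
    (i1.add i2).integrableOn
  have e4 := integral_add i1 i2
  simp only [Pi.add_apply] at e3
  linarith

end IsPrimitive

/-! ### The du Bois-Reymond lemma and continuous representatives -/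

/-- The primitive from -∞ vanishes left of the support of η, and right of it because η has mean
zero. -/
theorem exists_hasDerivAt_hasCompactSupport {η : ℝ → ℝ} (hη : ContDiff ℝ ∞ η)
    (hc : HasCompactSupport η) (h0 : ∫ x, η x = 0) :
    ∃ φ : ℝ → ℝ, ContDiff ℝ ∞ φ ∧ HasCompactSupport φ ∧ deriv φ = η := by
  have hi : Integrable η := hη.continuous.integrable_of_hasCompactSupport hc
  set φ : ℝ → ℝ := fun x => ∫ t in Iic x, η t with hφ
  have hd : ∀ x, HasDerivAt φ (η x) x := fun x => by
    have h1 := (hη.continuous.integral_hasStrictDerivAt 0 x).hasDerivAt.const_add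
      (∫ t in Iic 0, η t)
    have h2 : φ = fun y => (∫ t in Iic 0, η t) + ∫ t in (0 : ℝ)..y, η t := by
      ext y
      rw [← intervalIntegral.integral_Iic_sub_Iic hi.integrableOn hi.integrableOn]
      simp [hφ]
    rwa [h2]
  have hd' : deriv φ = η := funext fun x => (hd x).deriv
  refine ⟨φ, contDiff_infty_iff_deriv.2 ⟨fun x => (hd x).differentiableAt, hd' ▸ hη⟩, ?_, hd'⟩
  obtain ⟨R, hR⟩ := hc.isCompact.isBounded.subset_closedBall 0
  refine HasCompactSupport.intro (isCompact_closedBall (0 : ℝ) R) fun x hx => ?_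
  have hz : ∀ t, R < |t| → η t = 0 := fun t ht => by
    by_contra hne
    have := hR (subset_tsupport η hne)
    simp at this
    linarith
  simp only [Metric.mem_closedBall, dist_zero_right, Real.norm_eq_abs, not_le] at hx
  rcases lt_abs.1 hx with h | h
  · simp only [hφ]
    rw [setIntegral_eq_integral_of_forall_compl_eq_zero, h0]
    intro t ht
    exact hz t (lt_abs.2 (Or.inl (h.trans (not_le.1 ht))))
  · refine setIntegral_eq_zero_of_forall_eq_zero fun t ht => hz t (lt_abs.2 (Or.inr ?_))
    have : t ≤ x := ht
    linarith

/-- The du Bois-Reymond lemma on `ℝ`. -/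
theorem ae_eq_const_of_integral_mul_deriv_eq_zero {w : ℝ → ℝ} (hw : LocallyIntegrable w volume)
    (h : ∀ φ : ℝ → ℝ, ContDiff ℝ ∞ φ → HasCompactSupport φ → ∫ x, w x * deriv φ x = 0) :
    ∃ C : ℝ, w =ᵐ[volume] fun _ => C := by
  let ρ : ContDiffBump (0 : ℝ) := ⟨1, 2, one_pos, one_lt_two⟩
  set r : ℝ → ℝ := ρ.normed volume
  have hr : ContDiff ℝ ∞ r := ρ.contDiff_normed
  have hrc : HasCompactSupport r := ρ.hasCompactSupport_normed
  have hr1 : ∫ x, r x = 1 := ρ.integral_normed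
  have hwi : ∀ ψ : ℝ → ℝ, ContDiff ℝ ∞ ψ → HasCompactSupport ψ →
      Integrable fun x => w x * ψ x := fun ψ h1 h2 => by
    have := hw.integrable_smul_left_of_hasCompactSupport h1.continuous h2
    simpa [mul_comm] using! this
  refine ⟨∫ x, w x * r x, ae_eq_of_integral_contDiff_smul_eq hw
    (locallyIntegrable_const _) fun ψ hψ hψc => ?_⟩
  set I := ∫ x, ψ x with hI
  have hrc' : HasCompactSupport fun x => I * r x := hrc.mul_left
  have hψi : Integrable ψ := hψ.continuous.integrable_of_hasCompactSupport hψc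
  have hri : Integrable r := hr.continuous.integrable_of_hasCompactSupport hrc
  -- Subtracting I times the unit-mass bump r leaves mean zero, hence the derivative of a test
  -- function.
  obtain ⟨φ, hφ, hφc, hφd⟩ := exists_hasDerivAt_hasCompactSupport
    (η := fun x => ψ x - I * r x) (hψ.sub (contDiff_const.mul hr))
    (hψc.sub hrc') (by
      rw [integral_sub hψi (hri.const_mul _), integral_const_mul, hr1, ← hI]; ring)
  have h1 := h φ hφ hφc
  rw [hφd] at h1
  have h2 : ∀ x, w x * (ψ x - I * r x) = w x * ψ x - I * (w x * r x) := fun x => by ring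
  simp only [h2] at h1
  rw [integral_sub (hwi ψ hψ hψc) ((hwi r hr hrc).const_mul _), integral_const_mul] at h1
  simp only [smul_eq_mul, mul_comm (ψ _)]
  rw [integral_const_mul, ← hI]
  linarith

/-- A function with a weak derivative agrees almost everywhere with an indefinite integral of
that derivative. -/
theorem HasWeakDeriv.exists_isPrimitive {u g : ℝ → ℝ} (h : HasWeakDeriv u g) :
    ∃ U, IsPrimitive U g ∧ u =ᵐ[volume] U := by
  have hp := isPrimitive_integral h.2.1 0
  set W : ℝ → ℝ := fun x => 0 + ∫ t in (0 : ℝ)..x, g t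
  have hW := hp.hasWeakDeriv
  have hmi : ∀ v : ℝ → ℝ, LocallyIntegrable v volume → ∀ φ : ℝ → ℝ, ContDiff ℝ ∞ φ →
      HasCompactSupport φ → Integrable fun x => v x * deriv φ x := fun v hv φ h1 h2 => by
    have := hv.integrable_smul_left_of_hasCompactSupport
      (contDiff_infty_iff_deriv.1 h1).2.continuous h2.deriv
    simpa [mul_comm] using! this
  -- The difference u - W has weak derivative zero.
  obtain ⟨C, hC⟩ := ae_eq_const_of_integral_mul_deriv_eq_zero (h.1.sub hW.1)
    fun φ hφ hc => by
      have e1 := h.2.2 φ hφ hc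
      have e2 := hW.2.2 φ hφ hc
      simp only [Pi.sub_apply, sub_mul]
      rw [integral_sub (hmi _ h.1 φ hφ hc) (hmi _ hW.1 φ hφ hc)]
      linarith
  refine ⟨_, isPrimitive_integral h.2.1 C, ?_⟩
  filter_upwards [hC] with x hx
  simp only [Pi.sub_apply, W] at hx
  linarith

theorem HasWeakDeriv.congr_ae {u v g : ℝ → ℝ} (h : HasWeakDeriv u g) (huv : u =ᵐ[volume] v) :
    HasWeakDeriv v g := by
  refine ⟨h.1.congr huv, h.2.1, fun φ hφ hc => ?_⟩
  rw [← h.2.2 φ hφ hc]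
  refine integral_congr_ae ?_
  filter_upwards [huv] with x hx
  rw [hx]


/-! ### Completing the square and decay at infinity -/

/-- The weight equal to `1` on `(-∞, a]` and to `-1` on `(a, ∞)`. -/
noncomputable def stepSign (a x : ℝ) : ℝ := if x ≤ a then 1 else -1

theorem measurable_stepSign (a : ℝ) : Measurable (stepSign a) :=
  Measurable.ite measurableSet_Iic measurable_const measurable_const

theorem abs_stepSign (a x : ℝ) : |stepSign a x| = 1 := by
  unfold stepSign; split_ifs <;> simp

theorem stepSign_sq (a x : ℝ) : stepSign a x ^ 2 = 1 := by
  rw [← sq_abs, abs_stepSign, one_pow]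

theorem _root_.MeasureTheory.MemLp.stepSign_mul {f : ℝ → ℝ} (hf : MemLp f 2 volume) (a : ℝ) :
    MemLp (fun x => stepSign a x * f x) 2 volume := by
  refine hf.of_le ((measurable_stepSign a).aestronglyMeasurable.mul hf.1) (.of_forall fun x => ?_)
  rw [norm_mul, Real.norm_eq_abs, abs_stepSign, one_mul]

theorem integral_stepSign_mul {f : ℝ → ℝ} (hf : Integrable f) (a : ℝ) :
    ∫ x, stepSign a x * f x = (∫ x in Iic a, f x) - ∫ x in Ioi a, f x := by
  have hi : Integrable fun x => stepSign a x * f x :=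
    hf.bdd_mul (c := 1) (measurable_stepSign a).aestronglyMeasurable
      (.of_forall fun x => by rw [Real.norm_eq_abs, abs_stepSign])
  rw [← intervalIntegral.integral_Iic_add_Ioi (b := a) hi.integrableOn hi.integrableOn,
    setIntegral_congr_fun (g := f) measurableSet_Iic fun x hx => by
      simp [stepSign, mem_Iic.1 hx],
    setIntegral_congr_fun (g := fun x => -f x) measurableSet_Ioi fun x hx => by
      simp [stepSign, not_le.2 (mem_Ioi.1 hx)], integral_neg]
  ring

/-- Completing the square on either side of `a`. -/
theorem IsPrimitive.integral_sq_add {U g : ℝ → ℝ} (h : IsPrimitive U g) (hU : MemLp U 2 volume)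
    (hg : MemLp g 2 volume) (s a : ℝ) :
    ∫ x, (|g x| ^ 2 + s ^ 2 * |U x| ^ 2) =
      (∫ x, (g x - s * (stepSign a x * U x)) ^ 2) + 2 * s * U a ^ 2 := by
  have hp := h.mul h
  have i1 : Integrable fun x => g x * U x := hg.integrable_mul hU
  have i1' : Integrable fun x => U x * g x := hU.integrable_mul hg
  have i2 : Integrable fun x => U x * U x := hU.integrable_mul hU
  have e1 := hp.integral_Ioi (i1.add i1') i2 a
  have e2 := hp.integral_Iic (i1.add i1') i2 a
  have e3 := integral_stepSign_mul (i1.add i1') a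
  simp only [Pi.add_apply] at e3
  rw [e1, e2] at e3
  have i3 : Integrable fun x => (g x - s * (stepSign a x * U x)) ^ 2 :=
    (hg.sub ((hU.stepSign_mul a).const_mul s)).integrable_sq
  have i4 : Integrable fun x => stepSign a x * (g x * U x + U x * g x) :=
    (i1.add i1').bdd_mul (c := 1) (measurable_stepSign a).aestronglyMeasurable
      (.of_forall fun x => by rw [Real.norm_eq_abs, abs_stepSign])
  have e4 := integral_add i3 (i4.const_mul s)
  rw [integral_const_mul, e3] at e4
  rw [show 2 * s * U a ^ 2 = s * (U a * U a - -(U a * U a)) by ring, ← e4]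
  refine integral_congr_ae (.of_forall fun x => ?_)
  have := stepSign_sq a x
  simp only [sq_abs]
  linear_combination (-(s ^ 2) * U x ^ 2) * this

/-- U² is a primitive of the integrable function 2gU and is itself integrable, so its limits at ±∞
are 0. -/
theorem IsPrimitive.tendsto_zero {U g : ℝ → ℝ} (h : IsPrimitive U g) (hU : MemLp U 2 volume)
    (hg : MemLp g 2 volume) : Tendsto U (cocompact ℝ) (𝓝 0) := by
  have hp := h.mul h
  have i1 : Integrable fun x => g x * U x + U x * g x :=
    (hg.integrable_mul hU).add (hU.integrable_mul hg)
  have i2 : Integrable fun x => U x * U x := hU.integrable_mul hU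
  have key : Tendsto (fun x => U x * U x) (cocompact ℝ) (𝓝 0) := by
    rw [cocompact_eq_atBot_atTop, tendsto_sup]
    constructor
    · have h1 := (intervalIntegral_tendsto_integral_Iic 0 i1.integrableOn
        tendsto_id).const_sub (U 0 * U 0)
      rw [hp.integral_Iic i1 i2, sub_self] at h1
      refine h1.congr fun x => ?_
      simp [← hp.2]
    · have h1 := (intervalIntegral_tendsto_integral_Ioi 0 i1.integrableOn
        tendsto_id).const_add (U 0 * U 0)
      rw [hp.integral_Ioi i1 i2, add_neg_cancel] at h1
      refine h1.congr fun x => ?_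
      simp [← hp.2]
  rw [tendsto_zero_iff_abs_tendsto_zero]
  have := key.sqrt
  simpa [Real.sqrt_mul_self_eq_abs] using! this

theorem IsPrimitive.exists_forall_abs_le {U g : ℝ → ℝ} (h : IsPrimitive U g)
    (hU : MemLp U 2 volume) (hg : MemLp g 2 volume) : ∃ a, ∀ x, |U x| ≤ |U a| := by
  by_cases hz : ∀ x, U x = 0
  · exact ⟨0, fun x => by simp [hz]⟩
  obtain ⟨b, hb⟩ := not_forall.1 hz
  have h1 := (tendsto_zero_iff_abs_tendsto_zero _).1 (h.tendsto_zero hU hg)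
  exact h.continuous.abs.exists_forall_ge' b (h1.eventually_le_const (abs_pos.2 hb))

/-! ### The sup norm and the lower bound -/

theorem supNorm_congr_ae {u v : ℝ → ℝ} (h : u =ᵐ[volume] v) : supNorm u = supNorm v := by
  rw [supNorm, supNorm, eLpNorm_congr_ae h]

theorem supNorm_eq_of_forall_abs_le {U : ℝ → ℝ} (hU : Continuous U) {a : ℝ}
    (ha : ∀ x, |U x| ≤ |U a|) : supNorm U = |U a| := by
  have h1 : eLpNorm U ⊤ volume ≤ ENNReal.ofReal |U a| := by
    rw [eLpNorm_exponent_top]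
    exact eLpNormEssSup_le_of_ae_bound (.of_forall ha)
  have h2 : ‖U a‖ₑ ≤ eLpNorm U ⊤ volume := by
    rw [eLpNorm_exponent_top]
    have hd := Measure.dense_of_ae (ae_le_eLpNormEssSup (f := U) (μ := volume))
    -- By continuity the a.e. bound holds on a closed dense set, hence at a.
    have hcl : IsClosed {x | ‖U x‖ₑ ≤ eLpNormEssSup U volume} :=
      isClosed_le hU.enorm continuous_const
    have : a ∈ {x | ‖U x‖ₑ ≤ eLpNormEssSup U volume} := by
      rw [← hcl.closure_eq]; exact hd a
    exact this
  rw [supNorm, le_antisymm h1 (by rwa [← Real.enorm_eq_ofReal_abs]),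
    ENNReal.toReal_ofReal (abs_nonneg _)]

theorem energy_eq {u g U : ℝ → ℝ} (h : HasWeakDeriv u g) (hu : u =ᵐ[volume] U) (V : ℝ → ℝ) :
    energy u V = ∫ x, (|g x| ^ 2 + V x * |U x| ^ 2) := by
  refine integral_congr_ae ?_
  filter_upwards [h.weakDeriv_ae_eq, hu] with x h1 h2
  rw [h1, h2]

/-- Every nonzero `u` in `H¹(ℝ)` has a continuous representative `U` with weak derivative `g` for
which `R(u; s²)` exceeds `2s` by a multiple of an explicit integral of a square. -/
theorem exists_rayleigh_eq {u : ℝ → ℝ} (hu : u ∈ H1) (h0 : ¬ u =ᵐ[volume] 0) (s : ℝ) :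
    ∃ U g a, IsPrimitive U g ∧ MemLp U 2 volume ∧ MemLp g 2 volume ∧ u =ᵐ[volume] U ∧ U a ≠ 0 ∧
      rayleigh u (fun _ => s ^ 2) =
        (∫ x, (g x - s * (stepSign a x * U x)) ^ 2) / U a ^ 2 + 2 * s := by
  obtain ⟨hu2, g, hg, hg2⟩ := hu
  obtain ⟨U, hp, hU⟩ := hg.exists_isPrimitive
  have hU2 := hu2.ae_eq hU
  obtain ⟨a, ha⟩ := hp.exists_forall_abs_le hU2 hg2
  have hne : U a ≠ 0 := fun h => h0 (hU.trans (.of_forall fun x => by simpa [h] using ha x))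
  refine ⟨U, g, a, hp, hU2, hg2, hU, hne, ?_⟩
  rw [rayleigh, energy_eq hg hU, hp.integral_sq_add hU2 hg2 s a, supNorm_congr_ae hU,
    supNorm_eq_of_forall_abs_le hp.continuous ha, sq_abs]
  field_simp

theorem two_mul_le_rayleigh {u : ℝ → ℝ} (hu : u ∈ H1) (h0 : ¬ u =ᵐ[volume] 0) (s : ℝ) :
    2 * s ≤ rayleigh u (fun _ => s ^ 2) := by
  obtain ⟨U, g, a, -, -, -, -, -, h⟩ := exists_rayleigh_eq hu h0 s
  rw [h]
  have : 0 ≤ (∫ x, (g x - s * (stepSign a x * U x)) ^ 2) / U a ^ 2 :=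
    div_nonneg (integral_nonneg fun x => sq_nonneg _) (sq_nonneg _)
  linarith

/-! ### The equality case -/

theorem IsPrimitive.eq_exp {U g : ℝ → ℝ} (h : IsPrimitive U g) {s a : ℝ}
    (hg : ∀ᵐ x, g x = s * (stepSign a x * U x)) (x : ℝ) :
    U x = U a * Real.exp (-s * |x - a|) := by
  -- Integrating factor: U(y) e^{-t(y-a)} has a.e. derivative 0 between a and x. Here t = s left of
  -- a and t = -s right of it.
  have key : ∀ t : ℝ, (∀ᵐ y, y ∈ uIoc a x → g y = t * U y) →
      U x = U a * Real.exp (t * (x - a)) := fun t ht => by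
    have hE : ContDiff ℝ 1 fun y : ℝ => Real.exp (-t * (y - a)) := by fun_prop
    have hd : ∀ y, deriv (fun y : ℝ => Real.exp (-t * (y - a))) y =
        Real.exp (-t * (y - a)) * -t := fun y => by
      have := (((hasDerivAt_id y).sub_const a).const_mul (-t)).exp
      simpa using! this.deriv
    have h1 := (h.mul hE.isPrimitive).2 a x
    rw [intervalIntegral.integral_congr_ae (g := fun _ => 0)] at h1
    · simp only [sub_self, mul_zero, Real.exp_zero, mul_one,
        intervalIntegral.integral_zero] at h1
      rw [← sub_eq_zero.1 h1, mul_assoc, ← Real.exp_add]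
      simp
    · filter_upwards [ht] with y hy hm
      rw [hd, hy hm]
      ring
  rcases le_total x a with hx | hx
  · rw [key s ?_, abs_of_nonpos (by linarith)]
    · congr 2; ring
    · filter_upwards [hg] with y hy hm
      rw [uIoc_of_ge hx] at hm
      simp [hy, stepSign, hm.2]
  · rw [key (-s) ?_, abs_of_nonneg (by linarith)]
    filter_upwards [hg] with y hy hm
    rw [uIoc_of_le hx] at hm
    simp [hy, stepSign, not_le.2 hm.1]

theorem exists_ae_eq_exp_of_rayleigh_eq {u : ℝ → ℝ} (hu : u ∈ H1) (h0 : ¬ u =ᵐ[volume] 0) {s : ℝ}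
    (h : rayleigh u (fun _ => s ^ 2) = 2 * s) :
    ∃ c : ℝ, c ≠ 0 ∧ ∃ a : ℝ, u =ᵐ[volume] fun x => c * Real.exp (-s * |x - a|) := by
  obtain ⟨U, g, a, hp, hU2, hg2, huU, hne, hR⟩ := exists_rayleigh_eq hu h0 s
  have h1 : ∫ x, (g x - s * (stepSign a x * U x)) ^ 2 = 0 := by
    have : (∫ x, (g x - s * (stepSign a x * U x)) ^ 2) / U a ^ 2 = 0 := by linarith
    simpa [hne] using this
  have i3 : Integrable fun x => (g x - s * (stepSign a x * U x)) ^ 2 :=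
    (hg2.sub ((hU2.stepSign_mul a).const_mul s)).integrable_sq
  rw [integral_eq_zero_iff_of_nonneg (fun x => sq_nonneg _) i3] at h1
  refine ⟨U a, hne, a, huU.trans (.of_forall (hp.eq_exp ?_))⟩
  filter_upwards [h1] with x hx
  exact sub_eq_zero.1 (pow_eq_zero_iff two_ne_zero |>.1 hx)

/-! ### The exponentials attain the bound -/

theorem isPrimitive_exp (s c a : ℝ) :
    IsPrimitive (fun x => c * Real.exp (-s * |x - a|))
      (fun x => s * (stepSign a x * (c * Real.exp (-s * |x - a|)))) := by
  have hc : Continuous fun x : ℝ => c * Real.exp (-s * |x - a|) := by fun_prop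
  have hl : LocallyIntegrable (fun x => s * (stepSign a x * (c * Real.exp (-s * |x - a|))))
      volume := by
    refine (hc.const_mul s).locallyIntegrable.mono
      (((measurable_stepSign a).mul hc.measurable).const_mul s).aestronglyMeasurable
      (.of_forall fun x => ?_)
    simp only [norm_mul, Real.norm_eq_abs, abs_stepSign, one_mul, le_refl]
  refine ⟨hl, fun x y => ?_⟩
  -- The kink at a is the only point where differentiability is not available.
  refine (integral_eq_of_hasDerivAt_off_countable _ _ (countable_singleton a)
    hc.continuousOn (fun z hz => ?_) (hl.intervalIntegrable_real x y)).symm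
  have hz : z - a ≠ 0 := sub_ne_zero.2 hz.2
  have h1 := ((((hasDerivAt_abs hz).comp z ((hasDerivAt_id z).sub_const a)).const_mul
    (-s)).exp).const_mul c
  convert! h1 using 1
  rcases lt_or_gt_of_ne hz with h | h
  · simp [stepSign, sub_neg.1 h |>.le, h, mul_comm, mul_left_comm]
  · simp [stepSign, not_le.2 (sub_pos.1 h), h, mul_comm, mul_left_comm]

theorem integrable_exp_neg_mul_abs_sub {s : ℝ} (hs : 0 < s) (a : ℝ) :
    Integrable fun x : ℝ => Real.exp (-s * |x - a|) := by
  have h : Integrable fun x : ℝ => Real.exp (-s * |x|) := by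
    rw [← integrableOn_univ, ← Iic_union_Ioi (a := (0 : ℝ))]
    refine IntegrableOn.union ?_ ?_
    · refine (integrableOn_exp_mul_Iic hs 0).congr_fun (fun x hx => ?_) measurableSet_Iic
      simp [abs_of_nonpos (mem_Iic.1 hx)]
    · refine (integrableOn_exp_mul_Ioi (neg_lt_zero.2 hs) 0).congr_fun (fun x hx => ?_)
        measurableSet_Ioi
      simp [abs_of_pos (mem_Ioi.1 hx)]
  exact h.comp_sub_right a

theorem memLp_exp_neg_mul_abs_sub {s : ℝ} (hs : 0 < s) (c a : ℝ) :
    MemLp (fun x : ℝ => c * Real.exp (-s * |x - a|)) 2 volume := by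
  have hc : Continuous fun x : ℝ => c * Real.exp (-s * |x - a|) := by fun_prop
  rw [memLp_two_iff_integrable_sq hc.aestronglyMeasurable]
  refine ((integrable_exp_neg_mul_abs_sub (mul_pos two_pos hs) a).const_mul (c ^ 2)).congr
    (.of_forall fun x => ?_)
  simp only [mul_pow, ← Real.exp_nat_mul]
  congr 2
  push_cast
  ring

theorem rayleigh_exp {u : ℝ → ℝ} {s c a : ℝ} (hs : 0 < s) (hc : c ≠ 0)
    (hu : u =ᵐ[volume] fun x => c * Real.exp (-s * |x - a|)) :
    u ∈ H1 ∧ ¬ u =ᵐ[volume] 0 ∧ rayleigh u (fun _ => s ^ 2) = 2 * s := by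
  have hp := isPrimitive_exp s c a
  have hU2 := memLp_exp_neg_mul_abs_sub hs c a
  have hg2 := (hU2.stepSign_mul a).const_mul s
  have hw := hp.hasWeakDeriv.congr_ae hu.symm
  have hsup : supNorm u = |c| := by
    rw [supNorm_congr_ae hu, supNorm_eq_of_forall_abs_le (a := a) hp.continuous]
    · simp
    · intro x
      simp only [abs_mul, Real.abs_exp, sub_self, abs_zero, mul_zero, Real.exp_zero, abs_one]
      refine mul_le_mul_of_nonneg_left (Real.exp_le_one_iff.2 ?_) (abs_nonneg c)
      nlinarith [abs_nonneg (x - a)]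
  refine ⟨⟨hU2.ae_eq hu.symm, _, hw, hg2⟩, fun h => hc ?_, ?_⟩
  · have h2 := supNorm_congr_ae h
    rw [hsup] at h2
    simpa [supNorm] using h2
  · rw [rayleigh, energy_eq hw hu, hp.integral_sq_add hU2 hg2 s a, hsup]
    -- For the exponential, g = sσU, so the square vanishes identically and only 2s c² remains.
    simp
    field_simp

theorem isLeast_rayleigh {s : ℝ} (hs : 0 < s) :
    IsLeast {r | ∃ u ∈ H1, ¬ u =ᵐ[volume] 0 ∧ r = rayleigh u fun _ => s ^ 2} (2 * s) := by
  constructor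
  · obtain ⟨h1, h2, h3⟩ := rayleigh_exp (a := 0) hs one_ne_zero (ae_eq_refl _)
    exact ⟨_, h1, h2, h3.symm⟩
  · rintro r ⟨u, h1, h2, rfl⟩
    exact two_mul_le_rayleigh h1 h2 s

end SobolevBest

theorem mainTheorem12 (V : ℝ) (hV : 0 < V) :
    SobolevBest.m (fun _ => V) = 2 * Real.sqrt V ∧
    SobolevBest.M (fun _ => V) =
      {u : ℝ → ℝ | ∃ c : ℝ, c ≠ 0 ∧ ∃ a : ℝ,
        u =ᵐ[volume] fun x => c * Real.exp (-Real.sqrt V * |x - a|)} := by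
  have hs : 0 < Real.sqrt V := Real.sqrt_pos.2 hV
  have hV' : (fun _ : ℝ => V) = fun _ => Real.sqrt V ^ 2 := by rw [Real.sq_sqrt hV.le]
  have hm : SobolevBest.m (fun _ => V) = 2 * Real.sqrt V := by
    rw [hV']
    exact (SobolevBest.isLeast_rayleigh hs).csInf_eq
  refine ⟨hm, Set.ext fun u => ⟨?_, ?_⟩⟩
  · rintro ⟨h1, h2, h3⟩
    rw [hm, hV'] at h3
    exact SobolevBest.exists_ae_eq_exp_of_rayleigh_eq h1 h2 h3.symm
  · rintro ⟨c, hc, a, hu⟩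
    obtain ⟨h1, h2, h3⟩ := SobolevBest.rayleigh_exp hs hc hu
    refine ⟨h1, h2, ?_⟩
    rw [hm, hV']
    exact h3.symm
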